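/- Let $N\ge 2$ and let $\omega=(1/f,q,w)$ be the discrete Sturm–Liouville equation $$-\nabla(f_n\Delta y_n)+q_ny_n=\lambda w_ny_n,\qquad 1\le n\le N,$$ where $\Delta y_n=y_{n+1}-y_n$, $\nabla y_n=y_n-y_{n-1}$, $f_0,\dots,f_N$ are nonzero reals, $q_1,\dots,q_N$ are reals and $w_1,\dots,w_N>0$. For complex $2\times2$ matrices $A,B$ with $\operatorname{rank}(A,B)=2$ and $AEA^*=BEB^*$, $E=\begin{pmatrix}0&1\\-1&0\end{pmatrix}$, write $[A\,|\,B]$ for the self-adjoint boundary condition $$A\begin{pmatrix}y_0\\ f_0\Delta y_0\end{pmatrix}+B\begin{pmatrix}y_N\\ f_N\Delta y_N\end{pmatrix}=0 .$$ An eigenvalue of $(\omega,[A\,|\,B])$ is a $\lambda\in\mathbb C$ for which the equation together with the boundary condition has a nonzero solution $(y_0,\dots,y_{N+1})\in\mathbb C^{N+2}$; its multiplicity is the dimension of the space of solutions. Eigenvalues are counted with multiplicity. Fix $z\in\mathbb C$, and for $a_{12},b_{21}\in\mathbb R$ put $$\mathbf A(a_{12},b_{21})=\left[\begin{array}{cccc}1&a_{12}&\bar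 z&0\\0&z&b_{21}&1\end{array}\right],\quad \mathbf S_1=\mathbf S_1(b_{21})=\left[\begin{array}{cccc}0&1&0&0\\0&0&b_{21}&1\end{array}\right],\quad \mathbf S_2=\mathbf S_2(a_{12})=\left[\begin{array}{cccc}1&a_{12}&0&0\\0&0&1&0\end{array}\right],$$ where the first two columns form $A$ and the last two form $B$. **Theorem.** All eigenvalues of the problems below are real. $(\omega,\mathbf A(a_{12},b_{21}))$ has exactly $N$ eigenvalues if $a_{12}\ne 1/f_0$ and exactly $N-1$ if $a_{12}=1/f_0$; $(\omega,\mathbf S_1)$ has exactly $N$ eigenvalues in any case; $(\omega,\mathbf S_2)$ has exactly $N-1$ eigenvalues if $a_{12}\neq 1/f_0$ and exactly $N-2$ if $a_{12}=1/f_0$. For each problem let $\lambda_0\le\lambda_1\le\cdots$ be its eigenvalues in non-decreasing order, repeated according to multiplicity. (i) Let $a^{(1)}<a^{(2)}\le 1/f_0<a^{(3)}<a^{(4)}$ and $b_{21}\in\mathbb R$, and let $\lambda_n(a^{(i)})$ and $\lambda_n(\mathbf S_1)$ be the eigenvalues of $(\omega,\mathbf A(a^{(i)},b_{21}))$ and $(\omega,\mathbf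 S_1)$. Then $$\lambda_n(a^{(3)})\le\lambda_n(a^{(4)})\le\lambda_n(\mathbf S_1)\le\lambda_n(a^{(1)})\quad(0\le n\le N-1),$$ $$\lambda_n(a^{(1)})\le\lambda_n(a^{(2)})\le\lambda_{n+1}(a^{(3)})\quad(0\le n\le N-2),$$ and in addition $\lambda_{N-1}(a^{(1)})\le\lambda_{N-1}(a^{(2)})$ if $a^{(2)}<1/f_0$. (ii) Let $b^{(1)}<b^{(2)}$ and $a_{12}\in\mathbb R$, and let $\lambda_n(b^{(j)})$ and $\lambda_n(\mathbf S_2)$ be the eigenvalues of $(\omega,\mathbf A(a_{12},b^{(j)}))$ and $(\omega,\mathbf S_2)$. Then $$\lambda_n(b^{(1)})\le\lambda_n(b^{(2)})\quad(0\le n\le N-2),\qquad \lambda_n(b^{(2)})\le\lambda_n(\mathbf S_2)\le\lambda_{n+1}(b^{(1)})\quad(0\le n\le N-3),$$ and in addition $\lambda_{N-2}(b^{(2)})\le\lambda_{N-2}(\mathbf S_2)\le\lambda_{N-1}(b^{(1)})\le\lambda_{N-1}(b^{(2)})$ if $a_{12}\ne1/f_0$. -/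

import Mathlib

open scoped ComplexConjugate Matrix

namespace DiscreteSL

/-- A symmetric discrete Sturm-Liouville equation `ω = (1/f, q, w)` on `[1, N]`,
`-∇(f_n Δ y_n) + q_n y_n = λ w_n y_n`, `n = 1, …, N`, with real coefficients, `f_n ≠ 0` and `w_n > 0`.
`f i` is `f_i` for `i = 0, …, N`, while `q i` and `w i` are `q_{i+1}` and `w_{i+1}` for
`i = 0, …, N - 1`. -/
structure SLE (N : ℕ) where
  f : Fin (N + 1) → ℝ
  q : Fin N → ℝ
  w : Fin N → ℝ
  f_ne_zero : ∀ i, f i ≠ 0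
  w_pos : ∀ i, 0 < w i

/-- A self-adjoint boundary condition `[A | B]`, given by coefficient matrices: complex `2 × 2`
matrices with `rank (A, B) = 2` and `A E A* = B E B*`, where `E = (0, 1; -1, 0)`. -/
structure SelfAdjointBC where
  A : Matrix (Fin 2) (Fin 2) ℂ
  B : Matrix (Fin 2) (Fin 2) ℂ
  rank_eq : (Matrix.fromCols A B).rank = 2
  selfAdjoint : A * !![0, 1; -1, 0] * Aᴴ = B * !![0, 1; -1, 0] * Bᴴ

/-- Consecutive differences: `diff u` has entries `u_{i+1} - u_i`. -/
def diff {n : ℕ} (u : Fin (n + 1) → ℂ) : Fin n → ℂ :=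
  fun i => u i.succ - u i.castSucc

/-- The sequence `f_n Δ y_n`, `n = 0, …, N`, for `y = (y_0, …, y_{N+1})`. -/
def SLE.quasiDiff {N : ℕ} (ω : SLE N) (y : Fin (N + 2) → ℂ) : Fin (N + 1) → ℂ :=
  fun n => (ω.f n : ℂ) * diff y n

/-- `y = (y_0, …, y_{N+1})` solves the equation `ω` with spectral parameter `μ`. The index `i`
stands for `n = i + 1`, so that `y_n` is `y i.succ.castSucc`, and the backward difference of
`f_n Δ y_n` at `n` is entry `i` of `diff`. -/
def SLE.IsSolution {N : ℕ} (ω : SLE N) (μ : ℂ) (y : Fin (N + 2) → ℂ) : Prop :=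
  ∀ i : Fin N, -diff (ω.quasiDiff y) i + (ω.q i : ℂ) * y i.succ.castSucc
    = μ * (ω.w i : ℂ) * y i.succ.castSucc

/-- `A (y_0, f_0 Δ y_0)ᵀ + B (y_N, f_N Δ y_N)ᵀ = 0`. -/
def SelfAdjointBC.Holds {N : ℕ} (ω : SLE N) (bc : SelfAdjointBC) (y : Fin (N + 2) → ℂ) : Prop :=
  bc.A *ᵥ ![y 0, ω.quasiDiff y 0]
    + bc.B *ᵥ ![y (Fin.last N).castSucc, ω.quasiDiff y (Fin.last N)] = 0

/-- The space of all solutions of the problem `(ω, bc)` with spectral parameter `μ`. The number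
`μ` is an eigenvalue if this space is nonzero, and its dimension is the multiplicity of `μ`. -/
def eigenspace {N : ℕ} (ω : SLE N) (bc : SelfAdjointBC) (μ : ℂ) :
    Submodule ℂ (Fin (N + 2) → ℂ) where
  carrier := {y | ω.IsSolution μ y ∧ bc.Holds ω y}
  zero_mem' := by
    refine ⟨fun i => by simp [diff, SLE.quasiDiff], ?_⟩
    ext j
    fin_cases j <;> simp [diff, SLE.quasiDiff]
  add_mem' := by
    rintro x y ⟨hx, hx'⟩ ⟨hy, hy'⟩
    refine ⟨fun i => ?_, ?_⟩
    · have h1 := hx i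
      have h2 := hy i
      simp only [diff, SLE.quasiDiff, Pi.add_apply] at h1 h2 ⊢
      linear_combination h1 + h2
    · ext j
      have h1 := congrFun hx' j
      have h2 := congrFun hy' j
      simp only [diff, SLE.quasiDiff, Pi.add_apply, Matrix.mulVec, dotProduct, Fin.sum_univ_two,
        Pi.zero_apply, Matrix.cons_val_zero, Matrix.cons_val_one] at h1 h2 ⊢
      linear_combination h1 + h2
  smul_mem' := by
    rintro c y ⟨hy, hy'⟩
    refine ⟨fun i => ?_, ?_⟩
    · have h2 := hy i
      simp only [diff, SLE.quasiDiff, Pi.smul_apply, smul_eq_mul] at h2 ⊢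
      linear_combination c * h2
    · ext j
      have h2 := congrFun hy' j
      simp only [diff, SLE.quasiDiff, Pi.add_apply, Pi.smul_apply, smul_eq_mul, Matrix.mulVec,
        dotProduct, Fin.sum_univ_two, Pi.zero_apply, Matrix.cons_val_zero,
        Matrix.cons_val_one] at h2 ⊢
      linear_combination c * h2

/-- The problem `(ω, bc)` has exactly `k` eigenvalues, counted with multiplicity, they are all
real, and in non-decreasing order they are `lam 0 ≤ lam 1 ≤ ⋯ ≤ lam (k - 1)`: every complex
number `μ` occurs among them exactly as often as its multiplicity says. (The values `lam n`
with `n ≥ k` play no role.) -/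
def IsEigenvalueSeq {N : ℕ} (ω : SLE N) (bc : SelfAdjointBC) (k : ℕ) (lam : ℕ → ℝ) : Prop :=
  (∀ m n, m ≤ n → n < k → lam m ≤ lam n) ∧
  ∀ μ : ℂ, Module.finrank ℂ (eigenspace ω bc μ)
    = ((Finset.range k).filter fun n => (lam n : ℂ) = μ).card

/-- The problem `(ω, bc)` has exactly `k` eigenvalues, counted with multiplicity, all real. -/
def HasExactlyEigenvalues {N : ℕ} (ω : SLE N) (bc : SelfAdjointBC) (k : ℕ) : Prop :=
  ∃ lam : ℕ → ℝ, IsEigenvalueSeq ω bc k lam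

theorem rank_eq_two_of_rows {M : Matrix (Fin 2) (Fin 2 ⊕ Fin 2) ℂ}
    (h : ∀ s t : ℂ, (∀ j, s * M 0 j + t * M 1 j = 0) → s = 0 ∧ t = 0) : M.rank = 2 := by
  have hli : LinearIndependent ℂ M.row := by
    rw [Fintype.linearIndependent_iff]
    intro g hg
    have := h (g 0) (g 1) (fun j => by
      have := congrFun hg j
      simpa [Fin.sum_univ_two, Matrix.row] using this)
    intro i
    fin_cases i
    · exact this.1
    · exact this.2
  simpa using hli.rank_matrix

/-- The boundary condition `A(a₁₂, b₂₁) = [1, a₁₂, z̄, 0; 0, z, b₂₁, 1]` of the chart `O_{1,4}`. -/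
noncomputable def chart14 (z : ℂ) (a₁₂ b₂₁ : ℝ) : SelfAdjointBC where
  A := !![1, (a₁₂ : ℂ); 0, z]
  B := !![conj z, 0; (b₂₁ : ℂ), 1]
  rank_eq := rank_eq_two_of_rows fun s t h => by
    have h1 := h (Sum.inl 0)
    have h2 := h (Sum.inr 1)
    simpa using And.intro h1 h2
  selfAdjoint := by
    ext i j
    fin_cases i <;> fin_cases j <;>
      simp [Matrix.mul_apply, Fin.sum_univ_two, Matrix.conjTranspose_apply]

/-- The limit boundary condition `S₁ = [0, 1, 0, 0; 0, 0, b₂₁, 1]`. -/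
noncomputable def limitS₁ (b₂₁ : ℝ) : SelfAdjointBC where
  A := !![0, 1; 0, 0]
  B := !![0, 0; (b₂₁ : ℂ), 1]
  rank_eq := rank_eq_two_of_rows fun s t h => by
    have h1 := h (Sum.inl 1)
    have h2 := h (Sum.inr 1)
    simpa using And.intro h1 h2
  selfAdjoint := by
    ext i j
    fin_cases i <;> fin_cases j <;>
      simp [Matrix.mul_apply, Fin.sum_univ_two, Matrix.conjTranspose_apply]

/-- The limit boundary condition `S₂ = [1, a₁₂, 0, 0; 0, 0, 1, 0]`. -/
noncomputable def limitS₂ (a₁₂ : ℝ) : SelfAdjointBC where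
  A := !![1, (a₁₂ : ℂ); 0, 0]
  B := !![0, 0; 1, 0]
  rank_eq := rank_eq_two_of_rows fun s t h => by
    have h1 := h (Sum.inl 0)
    have h2 := h (Sum.inr 0)
    simpa using And.intro h1 h2
  selfAdjoint := by
    ext i j
    fin_cases i <;> fin_cases j <;>
      simp [Matrix.mul_apply, Fin.sum_univ_two, Matrix.conjTranspose_apply]

end DiscreteSL

/-! Everything reduces to the Courant–Fischer principle for Hermitian forms on the interior values
`x = (y_1, …, y_N)`. Summation by parts turns the equation into the weak identity energy = `μ` ·
weight, with boundary terms in `p₀ = f_0 Δ y_0` and `p₁ = f_N Δ y_N`. Since `y_0 = y_1 - p₀ / f_0`,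
the boundary condition can be written in `(y_1, y_N)` and `(p₀, p₁)`. With `c = a₁₂ - 1 / f_0` it
amounts to adding `-(1/c)|y_1 + z̄ y_N|² + b₂₁|y_N|²` to the energy. For `c = 0` the first term is
replaced by the constraint `y_1 + z̄ y_N = 0`; `S₁` is the case `1/c = 0`, and `S₂` imposes `y_N =
0`, the limit of infinite `b₂₁`. `Reduces` records this, and `Reduces.finrank_eigenspace` shows that
no multiplicity is lost.

Each problem thus becomes a Hermitian form relative to a positive definite weight on a space of
dimension `N`, `N - 1` or `N - 2`, which gives reality and the counts. The inequalities follow from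
`eigenvalue_le`: a larger form has larger eigenvalues, shrinking the domain does not lower them, and
a constraint of codimension `d` shifts the index by at most `d`. Along the loops the form is
monotone in `-1/c` and in `b₂₁`. -/

namespace DiscreteSL

open Module

/-! ### Uniqueness of sorted eigenvalue lists. -/

section SortedSequences

/-- Two sorted finite sequences in which every number occurs equally often are equal. -/
theorem sorted_seq_unique {k k' : ℕ} {lam lam' : ℕ → ℝ}
    (hm : ∀ m n, m ≤ n → n < k → lam m ≤ lam n)
    (hm' : ∀ m n, m ≤ n → n < k' → lam' m ≤ lam' n)
    (hc : ∀ μ : ℂ, ((Finset.range k).filter fun n => (lam n : ℂ) = μ).card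
      = ((Finset.range k').filter fun n => (lam' n : ℂ) = μ).card) :
    k = k' ∧ ∀ n, n < k → lam n = lam' n := by
  have hsorted : ∀ (j : ℕ) (l : ℕ → ℝ), (∀ m n, m ≤ n → n < j → l m ≤ l n) →
      ((List.range j).map l).Pairwise (· ≤ ·) := by
    intro j l hl
    rw [List.pairwise_map]
    refine List.Pairwise.imp_of_mem ?_ List.pairwise_lt_range
    intro a b _ hb hab
    exact hl a b hab.le (List.mem_range.1 hb)
  have hcount : ∀ (j : ℕ) (l : ℕ → ℝ) (a : ℝ), ((List.range j).map l).count a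
      = ((Finset.range j).filter fun n => (l n : ℂ) = (a : ℂ)).card := by
    intro j l a
    rw [← Multiset.coe_count, ← Multiset.map_coe, Multiset.count_map]
    simp only [Finset.card, Finset.filter_val, Finset.range_val, Complex.ofReal_inj]
    congr 1
    refine Multiset.filter_congr fun x _ => ?_
    exact eq_comm
  -- Real `μ` suffice here: equal counts give a permutation, and two sorted lists that are
  -- permutations of each other coincide.
  have hperm : ((List.range k).map lam).Perm ((List.range k').map lam') := by
    rw [List.perm_iff_count]
    intro a
    rw [hcount, hcount]
    exact hc a
  have heq := List.Perm.eq_of_pairwise (fun a b _ _ h1 h2 => le_antisymm h1 h2)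
    (hsorted k lam hm) (hsorted k' lam' hm') hperm
  have hk : k = k' := by simpa using congrArg List.length heq
  subst hk
  refine ⟨rfl, fun n hn => ?_⟩
  have := List.map_inj_left.1 heq n (List.mem_range.2 hn)
  exact this

end SortedSequences

/-! ### Simultaneous diagonalization of a Hermitian form and a positive definite weight. -/

section Diagonalization

/-- The vectors whose coordinates in `s` vanish. -/
def zeroOn {k : ℕ} (s : Finset (Fin k)) : Submodule ℂ (Fin k → ℂ) :=
  ⨅ i ∈ (s : Set (Fin k)), LinearMap.ker (LinearMap.proj i : (Fin k → ℂ) →ₗ[ℂ] ℂ)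

theorem mem_zeroOn {k : ℕ} {s : Finset (Fin k)} {x : Fin k → ℂ} :
    x ∈ zeroOn s ↔ ∀ i ∈ s, x i = 0 := by
  simp [zeroOn, Submodule.mem_iInf]

theorem finrank_zeroOn {k : ℕ} (s : Finset (Fin k)) : finrank ℂ (zeroOn s) = sᶜ.card := by
  have e := LinearMap.iInfKerProjEquiv ℂ (fun _ : Fin k => ℂ)
    (I := ((sᶜ : Finset (Fin k)) : Set (Fin k))) (J := (s : Set (Fin k)))
    (by rw [Finset.coe_compl]; exact disjoint_compl_left) (by simp)
  rw [zeroOn, e.finrank_eq]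
  simp [Finset.card_compl]

variable {V : Type*} [AddCommGroup V] [Module ℂ V]

/-- The solutions `u` of `B(v, u) = μ W(v, u)` for all `v`. -/
def weakEigenspace (B W : V →ₗ⋆[ℂ] V →ₗ[ℂ] ℂ) (μ : ℂ) : Submodule ℂ V where
  carrier := {u | ∀ v, B v u = μ * W v u}
  zero_mem' := by simp
  add_mem' := by
    intro a b ha hb v
    rw [map_add, map_add, ha v, hb v, mul_add]
  smul_mem' := by
    intro c a ha v
    rw [map_smul, map_smul, ha v, smul_eq_mul, smul_eq_mul]
    ring

/-- The coordinates `e` turn `W` into the standard inner product and `B` into the diagonal form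
with entries `lam`. -/
structure Diagonalizes (B W : V →ₗ⋆[ℂ] V →ₗ[ℂ] ℂ) {k : ℕ} (e : V ≃ₗ[ℂ] (Fin k → ℂ))
    (lam : ℕ → ℝ) : Prop where
  weight : ∀ v u, W v u = ∑ i, conj (e v i) * e u i
  form : ∀ v u, B v u = ∑ i : Fin k, (lam i : ℂ) * (conj (e v i) * e u i)

/-- Taking `W` as the inner product makes `B` the form of a self-adjoint operator; the coordinates
come from an orthonormal eigenbasis of it. -/
theorem exists_diagonalizes [FiniteDimensional ℂ V] {B W : V →ₗ⋆[ℂ] V →ₗ[ℂ] ℂ}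
    (hB : ∀ u v, conj (B v u) = B u v) (hW : ∀ u v, conj (W v u) = W u v)
    (hpos : ∀ u, 0 ≤ (W u u).re) (hdef : ∀ u, W u u = 0 → u = 0) {k : ℕ}
    (hk : finrank ℂ V = k) :
    ∃ (e : V ≃ₗ[ℂ] (Fin k → ℂ)) (lam : ℕ → ℝ),
      (∀ m n, m ≤ n → n < k → lam m ≤ lam n) ∧ Diagonalizes B W e lam := by
  let core : InnerProductSpace.Core ℂ V :=
    { inner := fun x y => W x y
      conj_inner_symm := fun x y => hW x y
      re_inner_nonneg := hpos
      add_left := fun x y z => by simp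
      smul_left := fun x y r => by simp
      definite := hdef }
  let _ : NormedAddCommGroup V := core.toNormedAddCommGroup
  let _ : InnerProductSpace ℂ V := InnerProductSpace.ofCore core.toCore
  have hin : ∀ x y : V, inner ℂ x y = W x y := fun _ _ => rfl
  let o := stdOrthonormalBasis ℂ V
  -- The operator representing `B`: the coefficient of `T u` along `o i` must be `B (o i) u`.
  let T : V →ₗ[ℂ] V := ∑ i, (B (o i)).smulRight (o i)
  have hT : ∀ v u, inner ℂ v (T u) = B v u := by
    intro v u
    conv_rhs => rw [← o.sum_repr' v]
    simp only [T, LinearMap.sum_apply, LinearMap.smulRight_apply, inner_sum, inner_smul_right,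
      map_sum, LinearMap.map_smulₛₗ, LinearMap.smul_apply, smul_eq_mul, inner_conj_symm]
    exact Finset.sum_congr rfl fun i _ => mul_comm _ _
  have hsym : T.IsSymmetric := by
    intro x y
    rw [hT, ← inner_conj_symm, hT, hB]
  -- The spectral theorem lists eigenvalues in decreasing order, hence the reversal; indices from
  -- `k` on get the irrelevant value `0`.
  let b := (hsym.eigenvectorBasis hk).reindex Fin.revPerm
  have hanti := hsym.eigenvalues_antitone hk
  let lam : ℕ → ℝ := fun n => if h : n < k then hsym.eigenvalues hk (Fin.rev ⟨n, h⟩) else 0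
  have hlam : ∀ i : Fin k, lam i = hsym.eigenvalues hk (Fin.rev i) := fun i => by
    simp [lam]
  have hrepr : ∀ u i, b.repr u i = (hsym.eigenvectorBasis hk).repr u (Fin.rev i) := fun u i => by
    simp [b]
  refine ⟨b.repr.toLinearEquiv.trans (WithLp.linearEquiv 2 ℂ (Fin k → ℂ)), lam, ?_, ?_, ?_⟩
  · intro m n hmn hn
    have hm := hmn.trans_lt hn
    have h1 := hlam ⟨m, hm⟩
    have h2 := hlam ⟨n, hn⟩
    simp only at h1 h2
    rw [h1, h2]
    exact hanti (Fin.rev_le_rev.2 hmn)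
  · intro v u
    rw [← hin, ← b.repr.inner_map_map, PiLp.inner_apply]
    simp [mul_comm]
  · intro v u
    rw [← hT, ← b.repr.inner_map_map, PiLp.inner_apply]
    refine Finset.sum_congr rfl fun i _ => ?_
    have h := hsym.eigenvectorBasis_apply_self_apply hk u (Fin.rev i)
    simp only [LinearEquiv.trans_apply, WithLp.linearEquiv_apply,
      LinearIsometryEquiv.coe_toLinearEquiv, RCLike.inner_apply, hlam, hrepr, h]
    simp [hrepr]
    ring

namespace Diagonalizes

variable {B W : V →ₗ⋆[ℂ] V →ₗ[ℂ] ℂ} {k : ℕ} {e : V ≃ₗ[ℂ] (Fin k → ℂ)} {lam : ℕ → ℝ}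

theorem congr {lam' : ℕ → ℝ} (h : Diagonalizes B W e lam) (hl : ∀ n, n < k → lam n = lam' n) :
    Diagonalizes B W e lam' where
  weight := h.weight
  form v u := by
    rw [h.form]
    exact Finset.sum_congr rfl fun i _ => by rw [hl i i.2]

/-- In diagonal coordinates the weak equation decouples into `lam i * u i = μ * u i`, so the
solutions are the vectors supported where `lam i = μ`. -/
theorem finrank_weakEigenspace (h : Diagonalizes B W e lam) (μ : ℂ) :
    finrank ℂ (weakEigenspace B W μ)
      = ((Finset.range k).filter fun n => (lam n : ℂ) = μ).card := by
  have hmap : weakEigenspace B W μ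
      = (zeroOn (Finset.univ.filter fun i : Fin k => (lam i : ℂ) ≠ μ)).comap e.toLinearMap := by
    ext u
    simp only [Submodule.mem_comap, mem_zeroOn, Finset.mem_filter, Finset.mem_univ, true_and]
    change (∀ v, B v u = μ * W v u) ↔ _
    constructor
    · intro hu i hi
      -- Testing with the `i`-th eigenvector isolates the `i`-th coordinate.
      have := hu (e.symm (Pi.single i 1))
      rw [h.form, h.weight] at this
      simp [Pi.single_apply] at this
      rcases this with h1 | h1
      · exact absurd h1 hi
      · exact h1
    · intro hu v
      rw [h.form, h.weight, Finset.mul_sum]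
      refine Finset.sum_congr rfl fun i _ => ?_
      by_cases hi : (lam i : ℂ) = μ
      · rw [hi]
      · have := hu i hi
        simp only [LinearEquiv.coe_coe] at this
        simp [this]
  rw [hmap, show e.toLinearMap = e.symm.symm.toLinearMap from rfl,
    ← Submodule.map_equiv_eq_comap_symm e.symm, LinearEquiv.finrank_map_eq, finrank_zeroOn]
  rw [Finset.card_filter, ← Fin.sum_univ_eq_sum_range (fun n => if (lam n : ℂ) = μ then 1 else 0),
    ← Finset.card_filter]
  congr 1
  ext i
  simp

theorem weight_self (h : Diagonalizes B W e lam) (x : V) :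
    (W x x).re = ∑ i, Complex.normSq (e x i) := by
  rw [h.weight, Complex.re_sum]
  exact Finset.sum_congr rfl fun i _ => by rw [← Complex.normSq_eq_conj_mul_self, Complex.ofReal_re]

theorem form_self (h : Diagonalizes B W e lam) (x : V) :
    (B x x).re = ∑ i : Fin k, lam i * Complex.normSq (e x i) := by
  rw [h.form, Complex.re_sum]
  exact Finset.sum_congr rfl fun i _ => by
    rw [← Complex.normSq_eq_conj_mul_self, ← Complex.ofReal_mul, Complex.ofReal_re]

/-- On the span of the first `n + 1` eigenvectors the form is at most `lam n`. -/
theorem exists_le (h : Diagonalizes B W e lam) (hm : ∀ m n, m ≤ n → n < k → lam m ≤ lam n)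
    {n : ℕ} (hn : n < k) :
    ∃ A : Submodule ℂ V, finrank ℂ A = n + 1 ∧ ∀ x ∈ A, (B x x).re ≤ lam n * (W x x).re := by
  refine ⟨(zeroOn (Finset.Ioi (⟨n, hn⟩ : Fin k))).map e.symm.toLinearMap, ?_, ?_⟩
  · rw [LinearEquiv.finrank_map_eq, finrank_zeroOn, Finset.card_compl, Fin.card_Ioi,
      Fintype.card_fin]
    simp only
    omega
  · rintro _ ⟨y, hy, rfl⟩
    have hy' := mem_zeroOn.1 hy
    rw [h.weight_self, h.form_self, Finset.mul_sum]
    refine Finset.sum_le_sum fun i _ => ?_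
    by_cases hi : (⟨n, hn⟩ : Fin k) < i
    · have := hy' i (Finset.mem_Ioi.2 hi)
      simp [this]
    · exact mul_le_mul_of_nonneg_right (hm i n (Fin.le_def.1 (not_lt.1 hi)) hn)
        (Complex.normSq_nonneg _)

/-- On the span of the eigenvectors from index `n` on the form is at least `lam n`. -/
theorem exists_ge (h : Diagonalizes B W e lam) (hm : ∀ m n, m ≤ n → n < k → lam m ≤ lam n)
    {n : ℕ} (hn : n < k) :
    ∃ A : Submodule ℂ V, finrank ℂ A = k - n ∧ ∀ x ∈ A, lam n * (W x x).re ≤ (B x x).re := by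
  refine ⟨(zeroOn (Finset.Iio (⟨n, hn⟩ : Fin k))).map e.symm.toLinearMap, ?_, ?_⟩
  · rw [LinearEquiv.finrank_map_eq, finrank_zeroOn, Finset.card_compl, Fin.card_Iio,
      Fintype.card_fin]
  · rintro _ ⟨y, hy, rfl⟩
    have hy' := mem_zeroOn.1 hy
    rw [h.weight_self, h.form_self, Finset.mul_sum]
    refine Finset.sum_le_sum fun i _ => ?_
    by_cases hi : i < (⟨n, hn⟩ : Fin k)
    · have := hy' i (Finset.mem_Iio.2 hi)
      simp [this]
    · exact mul_le_mul_of_nonneg_right (hm n i (Fin.le_def.1 (not_lt.1 hi)) i.2)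
        (Complex.normSq_nonneg _)

end Diagonalizes

/-! ### Comparison of eigenvalues by counting dimensions. -/

/-- A lower bound for the dimension of the intersection of two subspaces of `U`. -/
theorem finrank_inf_ge [FiniteDimensional ℂ V] {A C U : Submodule ℂ V} (hA : A ≤ U) (hC : C ≤ U) :
    finrank ℂ A + finrank ℂ C ≤ finrank ℂ U + finrank ℂ (A ⊓ C : Submodule ℂ V) := by
  have h1 := Submodule.finrank_sup_add_finrank_inf_eq A C
  have h2 := Submodule.finrank_mono (sup_le hA hC)
  omega

/-- The restriction of a sesquilinear form to a subspace. -/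
def restrictForm (U : Submodule ℂ V) (B : V →ₗ⋆[ℂ] V →ₗ[ℂ] ℂ) : U →ₗ⋆[ℂ] U →ₗ[ℂ] ℂ :=
  LinearMap.mk₂'ₛₗ (starRingEnd ℂ) (RingHom.id ℂ) (fun v u => B v u)
    (by simp) (by simp) (by simp) (by simp)

@[simp]
theorem restrictForm_apply (U : Submodule ℂ V) (B : V →ₗ⋆[ℂ] V →ₗ[ℂ] ℂ) (v u : U) :
    restrictForm U B v u = B v u := rfl

/-- The comparison principle: if the first form is at least the second one on a subspace `Z` of
codimension at most `d` in the domain of the first form, then `lam₂ n ≤ lam₁ (n + d)`. -/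
theorem eigenvalue_le [FiniteDimensional ℂ V] {B₁ B₂ W : V →ₗ⋆[ℂ] V →ₗ[ℂ] ℂ}
    {V₁ V₂ Z : Submodule ℂ V} {k₁ k₂ : ℕ} {e₁ : V₁ ≃ₗ[ℂ] (Fin k₁ → ℂ)}
    {e₂ : V₂ ≃ₗ[ℂ] (Fin k₂ → ℂ)} {lam₁ lam₂ : ℕ → ℝ}
    (hpos : ∀ u, 0 ≤ (W u u).re) (hdef : ∀ u, (W u u).re = 0 → u = 0)
    (h₁ : Diagonalizes (restrictForm V₁ B₁) (restrictForm V₁ W) e₁ lam₁)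
    (h₂ : Diagonalizes (restrictForm V₂ B₂) (restrictForm V₂ W) e₂ lam₂)
    (hm₁ : ∀ m n, m ≤ n → n < k₁ → lam₁ m ≤ lam₁ n)
    (hm₂ : ∀ m n, m ≤ n → n < k₂ → lam₂ m ≤ lam₂ n)
    (hZ₁ : Z ≤ V₁) (hZ₂ : Z ≤ V₂) {d : ℕ} (hd : finrank ℂ V₁ ≤ finrank ℂ Z + d)
    (hle : ∀ x ∈ Z, (B₂ x x).re ≤ (B₁ x x).re) {n : ℕ} (hn₁ : n + d < k₁) (hn₂ : n < k₂) :
    lam₂ n ≤ lam₁ (n + d) := by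
  obtain ⟨A, hA, hA'⟩ := h₁.exists_le hm₁ hn₁
  obtain ⟨C, hC, hC'⟩ := h₂.exists_ge hm₂ hn₂
  have hk₂ : finrank ℂ V₂ = k₂ := by rw [e₂.finrank_eq]; simp
  have hAr : finrank ℂ (A.map V₁.subtype) = n + d + 1 := by
    rw [← hA]; exact Submodule.finrank_map_subtype_eq V₁ A
  have hCr : finrank ℂ (C.map V₂.subtype) = k₂ - n := by
    rw [← hC]; exact Submodule.finrank_map_subtype_eq V₂ C
  have i1 := finrank_inf_ge (Submodule.map_subtype_le V₁ A) hZ₁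
  have i2 := finrank_inf_ge (inf_le_right.trans hZ₂ : A.map V₁.subtype ⊓ Z ≤ V₂)
    (Submodule.map_subtype_le V₂ C)
  -- Cutting `A` with `Z` leaves dimension at least `n + 1`, and `C` has dimension `k₂ - n` in the
  -- `k₂`-dimensional `V₂`, so they share a nonzero vector. On it both Rayleigh quotient bounds
  -- hold.
  have hne : A.map V₁.subtype ⊓ Z ⊓ C.map V₂.subtype ≠ ⊥ := by
    intro hbot
    rw [hbot, finrank_bot] at i2
    omega
  obtain ⟨x, ⟨⟨hxA, hxZ⟩, hxC⟩, hx0⟩ := Submodule.exists_mem_ne_zero_of_ne_bot hne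
  obtain ⟨a, ha, rfl⟩ := hxA
  obtain ⟨c, hc, hca⟩ := hxC
  have e1 := hA' a ha
  have e2 := hC' c hc
  simp only [restrictForm_apply, Submodule.subtype_apply] at e1 e2 hca hxZ hx0
  rw [hca] at e2
  have e3 := hle _ hxZ
  have hp : 0 < (W a a).re := lt_of_le_of_ne (hpos _) fun h => hx0 (hdef _ h.symm)
  exact le_of_mul_le_mul_right (e2.trans (e3.trans e1)) hp

end Diagonalization

/-! ### The weak form of the difference equation on the interior values. -/

section WeakFormulation

variable {M : ℕ}

/-- The first and the last entry. -/
def boundaryValues (M : ℕ) : (Fin (M + 2) → ℂ) →ₗ[ℂ] ℂ × ℂ :=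
  (LinearMap.proj 0).prod (LinearMap.proj (Fin.last (M + 1)))

@[simp]
theorem boundaryValues_apply (x : Fin (M + 2) → ℂ) :
    boundaryValues M x = (x 0, x (Fin.last (M + 1))) := rfl

/-- The vector with given first and last entry and zeros in between. -/
def boundaryLift (M : ℕ) (ξ : ℂ × ℂ) : Fin (M + 2) → ℂ :=
  Pi.single 0 ξ.1 + Pi.single (Fin.last (M + 1)) ξ.2

theorem boundaryValues_boundaryLift (ξ : ℂ × ℂ) : boundaryValues M (boundaryLift M ξ) = ξ := by
  have h : Fin.last (M + 1) ≠ 0 := (Fin.last_pos).ne'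
  ext <;> simp [boundaryLift, h, h.symm]

/-- The first and last index differ, so the boundary values are onto `ℂ × ℂ` with kernel of
dimension `M`, and that kernel lies in every preimage. -/
theorem finrank_comap_boundaryValues (K : Submodule ℂ (ℂ × ℂ)) :
    finrank ℂ (K.comap (boundaryValues M)) = finrank ℂ K + M := by
  have hsurj : Function.Surjective (boundaryValues M) :=
    fun ξ => ⟨_, boundaryValues_boundaryLift ξ⟩
  have h1 := LinearMap.finrank_range_add_finrank_ker (boundaryValues M)
  rw [LinearMap.range_eq_top.2 hsurj, finrank_top, finrank_prod, finrank_self,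
    finrank_fintype_fun_eq_card, Fintype.card_fin] at h1
  let g := (boundaryValues M).restrict (p := K.comap (boundaryValues M)) (q := K) fun _ hx => hx
  have hg : Function.Surjective g := by
    rintro ⟨ξ, hξ⟩
    refine ⟨⟨boundaryLift M ξ, ?_⟩, Subtype.ext (boundaryValues_boundaryLift ξ)⟩
    rw [Submodule.mem_comap, boundaryValues_boundaryLift]
    exact hξ
  have h2 := LinearMap.finrank_range_add_finrank_ker g
  rw [LinearMap.range_eq_top.2 hg, finrank_top] at h2
  have hle : LinearMap.ker (boundaryValues M) ≤ K.comap (boundaryValues M) := by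
    intro x hx
    rw [Submodule.mem_comap, LinearMap.mem_ker.1 hx]
    exact K.zero_mem
  have hker : LinearMap.ker g
      = (LinearMap.ker (boundaryValues M)).comap (K.comap (boundaryValues M)).subtype := by
    ext x
    rw [LinearMap.mem_ker, Submodule.mem_comap, LinearMap.mem_ker, Subtype.ext_iff]
    rfl
  rw [hker, (Submodule.comapSubtypeEquivOfLe hle).finrank_eq] at h2
  omega

/-- The Hermitian form on boundary values that belongs to a boundary condition. -/
def boundaryForm (z : ℂ) (r b : ℝ) (η ξ : ℂ × ℂ) : ℂ :=
  -(r * (conj (η.1 + conj z * η.2) * (ξ.1 + conj z * ξ.2))) + b * (conj η.2 * ξ.2)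

theorem boundaryForm_self_re (z : ℂ) (r b : ℝ) (ξ : ℂ × ℂ) :
    (boundaryForm z r b ξ ξ).re
      = -(r * Complex.normSq (ξ.1 + conj z * ξ.2)) + b * Complex.normSq ξ.2 := by
  rw [boundaryForm, ← Complex.normSq_eq_conj_mul_self, ← Complex.normSq_eq_conj_mul_self]
  norm_cast

/-- The weighted inner product. -/
def weightForm (ω : SLE (M + 2)) :
    (Fin (M + 2) → ℂ) →ₗ⋆[ℂ] (Fin (M + 2) → ℂ) →ₗ[ℂ] ℂ :=
  LinearMap.mk₂'ₛₗ (starRingEnd ℂ) (RingHom.id ℂ)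
    (fun v x => ∑ i, (ω.w i : ℂ) * (conj (v i) * x i))
    (fun _ _ _ => by
      rw [← Finset.sum_add_distrib]
      exact Finset.sum_congr rfl fun i _ => by rw [Pi.add_apply, map_add]; ring)
    (fun _ _ _ => by
      rw [Finset.smul_sum]
      exact Finset.sum_congr rfl fun i _ => by
        rw [Pi.smul_apply, smul_eq_mul, smul_eq_mul, map_mul]; ring)
    (fun _ _ _ => by
      rw [← Finset.sum_add_distrib]
      exact Finset.sum_congr rfl fun i _ => by rw [Pi.add_apply]; ring)
    (fun _ _ _ => by
      rw [Finset.smul_sum]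
      exact Finset.sum_congr rfl fun i _ => by
        rw [Pi.smul_apply, smul_eq_mul, smul_eq_mul, RingHom.id_apply]; ring)

theorem weightForm_apply (ω : SLE (M + 2)) (v x : Fin (M + 2) → ℂ) :
    weightForm ω v x = ∑ i, (ω.w i : ℂ) * (conj (v i) * x i) := rfl

/-- The energy form without boundary contributions. -/
def innerEnergy (ω : SLE (M + 2)) (v x : Fin (M + 2) → ℂ) : ℂ :=
  ∑ j : Fin (M + 1), (ω.f j.succ.castSucc : ℂ) *
      (conj (v j.succ - v j.castSucc) * (x j.succ - x j.castSucc))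
    + ∑ i, (ω.q i : ℂ) * (conj (v i) * x i)

/-- The energy form of the equation with a boundary form. -/
def energyForm (ω : SLE (M + 2)) (z : ℂ) (r b : ℝ) :
    (Fin (M + 2) → ℂ) →ₗ⋆[ℂ] (Fin (M + 2) → ℂ) →ₗ[ℂ] ℂ :=
  LinearMap.mk₂'ₛₗ (starRingEnd ℂ) (RingHom.id ℂ)
    (fun v x => innerEnergy ω v x + boundaryForm z r b (boundaryValues M v) (boundaryValues M x))
    (fun u v x => by
      simp only [innerEnergy, boundaryForm, boundaryValues_apply, Pi.add_apply, Prod.fst_add,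
        Prod.snd_add, map_add, map_sub, map_mul, add_mul, sub_mul, mul_add, mul_sub, Finset.sum_add_distrib, Finset.sum_sub_distrib]
      ring)
    (fun c v x => by
      simp only [innerEnergy, boundaryForm, boundaryValues_apply, Pi.smul_apply, smul_eq_mul,
        map_mul, map_sub, map_add, mul_add, Finset.mul_sum]
      congr 1
      · congr 1 <;> exact Finset.sum_congr rfl fun i _ => by ring
      · ring)
    (fun u v x => by
      simp only [innerEnergy, boundaryForm, boundaryValues_apply, Pi.add_apply, Prod.fst_add,
        Prod.snd_add, map_add, map_sub, map_mul, add_mul, sub_mul, mul_add, mul_sub, Finset.sum_add_distrib, Finset.sum_sub_distrib]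
      ring)
    (fun c v x => by
      simp only [innerEnergy, boundaryForm, boundaryValues_apply, Pi.smul_apply, smul_eq_mul,
        map_mul, map_sub, map_add, mul_add, Finset.mul_sum, RingHom.id_apply]
      congr 1
      · congr 1 <;> exact Finset.sum_congr rfl fun i _ => by ring
      · ring)

theorem energyForm_apply (ω : SLE (M + 2)) (z : ℂ) (r b : ℝ) (v x : Fin (M + 2) → ℂ) :
    energyForm ω z r b v x
      = innerEnergy ω v x + boundaryForm z r b (boundaryValues M v) (boundaryValues M x) := rfl

theorem conj_weightForm (ω : SLE (M + 2)) (u v : Fin (M + 2) → ℂ) :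
    conj (weightForm ω v u) = weightForm ω u v := by
  simp only [weightForm_apply, map_sum, map_mul, Complex.conj_ofReal, Complex.conj_conj]
  exact Finset.sum_congr rfl fun i _ => by ring

theorem conj_energyForm (ω : SLE (M + 2)) (z : ℂ) (r b : ℝ) (u v : Fin (M + 2) → ℂ) :
    conj (energyForm ω z r b v u) = energyForm ω z r b u v := by
  simp only [energyForm_apply, innerEnergy, boundaryForm, boundaryValues_apply, map_sum, map_mul,
    map_add, map_sub, map_neg, Complex.conj_ofReal, Complex.conj_conj]
  congr 1
  · congr 1 <;> exact Finset.sum_congr rfl fun i _ => by ring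
  · ring

theorem weightForm_self_re (ω : SLE (M + 2)) (u : Fin (M + 2) → ℂ) :
    (weightForm ω u u).re = ∑ i, ω.w i * Complex.normSq (u i) := by
  rw [weightForm_apply, Complex.re_sum]
  exact Finset.sum_congr rfl fun i _ => by
    rw [← Complex.normSq_eq_conj_mul_self, ← Complex.ofReal_mul, Complex.ofReal_re]

theorem weightForm_nonneg (ω : SLE (M + 2)) (u : Fin (M + 2) → ℂ) :
    0 ≤ (weightForm ω u u).re := by
  rw [weightForm_self_re]
  exact Finset.sum_nonneg fun i _ => mul_nonneg (ω.w_pos i).le (Complex.normSq_nonneg _)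

theorem weightForm_definite (ω : SLE (M + 2)) (u : Fin (M + 2) → ℂ)
    (h : (weightForm ω u u).re = 0) : u = 0 := by
  rw [weightForm_self_re, Finset.sum_eq_zero_iff_of_nonneg fun i _ =>
    mul_nonneg (ω.w_pos i).le (Complex.normSq_nonneg _)] at h
  ext i
  have := h i (Finset.mem_univ i)
  rw [mul_eq_zero, Complex.normSq_eq_zero] at this
  exact this.resolve_left (ω.w_pos i).ne'

/-- Summation by parts. -/
theorem sum_mul_diff {n : ℕ} (v : Fin (n + 1) → ℂ) (P : Fin (n + 2) → ℂ) :
    ∑ i, v i * diff P i = v (Fin.last n) * P (Fin.last (n + 1)) - v 0 * P 0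
      - ∑ j : Fin n, (v j.succ - v j.castSucc) * P j.succ.castSucc := by
  have h1 : ∑ i, v i * P i.succ
      = ∑ j : Fin n, v j.castSucc * P j.succ.castSucc + v (Fin.last n) * P (Fin.last (n + 1)) := by
    rw [Fin.sum_univ_castSucc]
    simp
  have h2 : ∑ i, v i * P i.castSucc
      = v 0 * P 0 + ∑ j : Fin n, v j.succ * P j.succ.castSucc := by
    rw [Fin.sum_univ_succ]
    simp
  simp only [diff, mul_sub, sub_mul, Finset.sum_sub_distrib, h1, h2]
  ring

/-- The entries `y_1, …, y_N` of `y = (y_0, …, y_{N+1})`. -/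
def interior (M : ℕ) : (Fin (M + 4) → ℂ) →ₗ[ℂ] (Fin (M + 2) → ℂ) :=
  LinearMap.funLeft ℂ ℂ fun i => i.succ.castSucc

theorem interior_apply (y : Fin (M + 4) → ℂ) (i : Fin (M + 2)) :
    interior M y i = y i.succ.castSucc := rfl

/-- Pairing with a test vector and summing by parts leaves only the two end quasi-differences
outside the energy; this is where a boundary condition can enter. -/
theorem sum_conj_mul_equation (ω : SLE (M + 2)) (y : Fin (M + 4) → ℂ) (v : Fin (M + 2) → ℂ) :
    ∑ i, conj (v i) * (-diff (ω.quasiDiff y) i + (ω.q i : ℂ) * y i.succ.castSucc)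
      = innerEnergy ω v (interior M y) + conj (v 0) * ω.quasiDiff y 0
        - conj (v (Fin.last (M + 1))) * ω.quasiDiff y (Fin.last (M + 2)) := by
  have h := sum_mul_diff (fun i => conj (v i)) (ω.quasiDiff y)
  have h3 : ∑ j : Fin (M + 1), (conj (v j.succ) - conj (v j.castSucc))
        * ω.quasiDiff y j.succ.castSucc
      = ∑ j : Fin (M + 1), (ω.f j.succ.castSucc : ℂ) *
        (conj (v j.succ - v j.castSucc) * (interior M y j.succ - interior M y j.castSucc)) := by
    refine Finset.sum_congr rfl fun j _ => ?_
    simp only [SLE.quasiDiff, diff, interior_apply, map_sub, Fin.succ_castSucc]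
    ring
  have h4 : ∑ i, conj (v i) * (-diff (ω.quasiDiff y) i + (ω.q i : ℂ) * y i.succ.castSucc)
      = -∑ i, conj (v i) * diff (ω.quasiDiff y) i
        + ∑ i, (ω.q i : ℂ) * (conj (v i) * interior M y i) := by
    rw [← Finset.sum_neg_distrib, ← Finset.sum_add_distrib]
    exact Finset.sum_congr rfl fun i _ => by rw [interior_apply]; ring
  rw [h4, h, h3, innerEnergy]
  ring

/-- The equation in variational form. -/
theorem isSolution_iff (ω : SLE (M + 2)) (μ : ℂ) (y : Fin (M + 4) → ℂ) :
    ω.IsSolution μ y ↔ ∀ v, innerEnergy ω v (interior M y) + conj (v 0) * ω.quasiDiff y 0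
      - conj (v (Fin.last (M + 1))) * ω.quasiDiff y (Fin.last (M + 2))
        = μ * weightForm ω v (interior M y) := by
  constructor
  · intro h v
    rw [← sum_conj_mul_equation, weightForm_apply, Finset.mul_sum]
    refine Finset.sum_congr rfl fun i _ => ?_
    rw [h i, interior_apply]
    ring
  · intro h i
    have := h (Pi.single i 1)
    rw [← sum_conj_mul_equation, weightForm_apply] at this
    simp only [Pi.single_apply, apply_ite (starRingEnd ℂ), map_one, map_zero, ite_mul, one_mul,
      zero_mul, mul_ite, mul_zero, Finset.sum_ite_eq', Finset.mem_univ, if_true,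
      interior_apply] at this
    rw [this, mul_assoc]

/-! ### From boundary conditions to Hermitian forms with constraints. -/

/-- A self-adjoint boundary condition restricts the boundary values `(y_1, y_N)` to `K`, and the
boundary values of the quasi-difference are given by the boundary form up to `K`'s annihilator. -/
def Reduces (ω : SLE (M + 2)) (bc : SelfAdjointBC) (z : ℂ) (r b : ℝ)
    (K : Submodule ℂ (ℂ × ℂ)) : Prop :=
  ∀ x₀ x₁ p₀ p₁ : ℂ, bc.A *ᵥ ![x₀ - p₀ / ω.f 0, p₀] + bc.B *ᵥ ![x₁, p₁] = 0 ↔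
    (x₀, x₁) ∈ K ∧
      ∀ η ∈ K, conj η.1 * p₀ - conj η.2 * p₁ = boundaryForm z r b η (x₀, x₁)

variable {ω : SLE (M + 2)} {bc : SelfAdjointBC} {z : ℂ} {r b : ℝ} {K : Submodule ℂ (ℂ × ℂ)}

/-- Solving `f_0 Δ y_0 = p₀` for `y_0` gives `y_1 - p₀ / f_0`, the argument built into `Reduces`;
this is the origin of the critical value `1 / f_0`. -/
theorem Reduces.holds_iff (h : Reduces ω bc z r b K) (y : Fin (M + 4) → ℂ) :
    bc.Holds ω y ↔ boundaryValues M (interior M y) ∈ K ∧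
      ∀ η ∈ K, conj η.1 * ω.quasiDiff y 0 - conj η.2 * ω.quasiDiff y (Fin.last (M + 2))
        = boundaryForm z r b η (boundaryValues M (interior M y)) := by
  have hf : (ω.f 0 : ℂ) ≠ 0 := Complex.ofReal_ne_zero.2 (ω.f_ne_zero 0)
  have hy : y 0 = interior M y 0 - ω.quasiDiff y 0 / ω.f 0 := by
    rw [SLE.quasiDiff, mul_div_cancel_left₀ _ hf, interior_apply, diff]
    simp
  rw [SelfAdjointBC.Holds, hy]
  exact h _ _ _ _

/-- The weak eigenvalue problem has the same multiplicities. -/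
theorem Reduces.finrank_eigenspace (h : Reduces ω bc z r b K) (μ : ℂ) :
    finrank ℂ (eigenspace ω bc μ) = finrank ℂ (weakEigenspace
      (restrictForm (K.comap (boundaryValues M)) (energyForm ω z r b))
      (restrictForm (K.comap (boundaryValues M)) (weightForm ω)) μ) := by
  have hf₀ : (ω.f 0 : ℂ) ≠ 0 := Complex.ofReal_ne_zero.2 (ω.f_ne_zero 0)
  have hf₁ : (ω.f (Fin.last (M + 2)) : ℂ) ≠ 0 := Complex.ofReal_ne_zero.2 (ω.f_ne_zero _)
  have hmem : ∀ y : eigenspace ω bc μ, interior M y ∈ K.comap (boundaryValues M) := fun y =>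
    ((h.holds_iff y).1 y.2.2).1
  have hweak : ∀ y : eigenspace ω bc μ, (⟨interior M y, hmem y⟩ : K.comap (boundaryValues M)) ∈
      weakEigenspace (restrictForm (K.comap (boundaryValues M)) (energyForm ω z r b))
        (restrictForm (K.comap (boundaryValues M)) (weightForm ω)) μ := by
    intro y v
    have h1 := (isSolution_iff ω μ y).1 y.2.1 v
    have h2 := ((h.holds_iff y).1 y.2.2).2 (boundaryValues M v) v.2
    rw [restrictForm_apply, restrictForm_apply, energyForm_apply, ← h1, ← h2,
      boundaryValues_apply]
    ring
  let R := (((interior M).domRestrict (eigenspace ω bc μ)).codRestrict _ hmem).codRestrict _ hweak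
  have hR : ∀ y : eigenspace ω bc μ, ((R y : K.comap (boundaryValues M)) : Fin (M + 2) → ℂ)
      = interior M y := fun _ => rfl
  refine (LinearEquiv.ofBijective R ⟨?_, ?_⟩).finrank_eq
  · rw [injective_iff_map_eq_zero]
    intro y hy
    have hx : interior M y = 0 := by
      rw [← hR, hy]
      rfl
    -- With zero interior the weak identity only contains the end quasi-differences. Unit test
    -- vectors at the two ends make them vanish, and nonzero `f_0`, `f_N` then force `y_0 = y_{N+1}
    -- = 0`.
    have hsol := (isSolution_iff ω μ y).1 y.2.1
    have hi : ∀ v, innerEnergy ω v (0 : Fin (M + 2) → ℂ) = 0 := by simp [innerEnergy]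
    simp only [hx, hi, map_zero, mul_zero, zero_add] at hsol
    have hne : Fin.last (M + 1) ≠ 0 := (Fin.last_pos).ne'
    have hp₀ : ω.quasiDiff y 0 = 0 := by
      simpa [hne] using hsol (Pi.single 0 1)
    have hp₁ : ω.quasiDiff y (Fin.last (M + 2)) = 0 := by
      simpa [hne.symm] using hsol (Pi.single (Fin.last (M + 1)) 1)
    have hin : ∀ i : Fin (M + 2), (y : Fin (M + 4) → ℂ) i.succ.castSucc = 0 := fun i =>
      congrFun hx i
    rw [SLE.quasiDiff, mul_eq_zero, or_iff_right hf₀, diff] at hp₀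
    rw [SLE.quasiDiff, mul_eq_zero, or_iff_right hf₁, diff] at hp₁
    apply Subtype.ext
    funext i
    change (y : Fin (M + 4) → ℂ) i = 0
    induction i using Fin.lastCases with
    | last =>
      have := hin (Fin.last (M + 1))
      rw [Fin.succ_last] at this
      rw [this, sub_zero, Fin.succ_last] at hp₁
      exact hp₁
    | cast i =>
      induction i using Fin.cases with
      | zero =>
        have := hin 0
        rw [show (0 : Fin (M + 3)).succ = (0 : Fin (M + 2)).succ.castSucc from rfl, this,
          zero_sub, neg_eq_zero] at hp₀
        exact hp₀
      | succ i => exact hin i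
  · rintro ⟨⟨x, hxK⟩, hx⟩
    -- The residual of the equation without boundary terms, as an antilinear functional of the test
    -- vector; parameters `0 0` remove the boundary form.
    let g : (Fin (M + 2) → ℂ) →ₗ⋆[ℂ] ℂ :=
      ((μ • weightForm ω - energyForm ω z 0 0).flip x)
    have hg : ∀ v, g v = μ * weightForm ω v x - innerEnergy ω v x := by
      intro v
      simp [g, energyForm_apply, boundaryForm]
    have hxw : ∀ v ∈ K.comap (boundaryValues M),
        g v = boundaryForm z r b (boundaryValues M v) (boundaryValues M x) := by
      intro v hv
      have := hx ⟨v, hv⟩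
      rw [restrictForm_apply, restrictForm_apply, energyForm_apply] at this
      rw [hg, ← this]
      ring
    let p₀ := g (Pi.single 0 1)
    let p₁ := -g (Pi.single (Fin.last (M + 1)) 1)
    have hlift : ∀ ξ : ℂ × ℂ, g (boundaryLift M ξ) = conj ξ.1 * p₀ - conj ξ.2 * p₁ := by
      intro ξ
      have hs : ∀ (i : Fin (M + 2)) (c : ℂ), g (Pi.single i c) = conj c * g (Pi.single i 1) := by
        intro i c
        rw [← smul_eq_mul, ← LinearMap.map_smulₛₗ, ← Pi.single_smul, smul_eq_mul, mul_one]
      rw [boundaryLift, map_add, hs, hs _ ξ.2]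
      simp only [p₀, p₁]
      ring
    -- Vectors with zero boundary values are admissible tests for any `K`, and `g` vanishes on them.
    -- So `g` depends only on the end values, and its coefficients are the quasi-differences needed
    -- to extend `x`.
    have hgv : ∀ v, g v = conj (v 0) * p₀ - conj (v (Fin.last (M + 1))) * p₁ := by
      intro v
      have h0 : boundaryValues M (v - boundaryLift M (boundaryValues M v)) = 0 := by
        rw [map_sub, boundaryValues_boundaryLift, sub_self]
      have h1 := hxw (v - boundaryLift M (boundaryValues M v)) (by
        rw [Submodule.mem_comap, h0]
        exact K.zero_mem)
      rw [h0, map_sub, hlift] at h1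
      simpa [boundaryForm, sub_eq_zero] using h1
    -- The outer entries are chosen so that the end quasi-differences equal `p₀` and `p₁`.
    let y : Fin (M + 4) → ℂ := Fin.cons (x 0 - p₀ / ω.f 0)
      (Fin.snoc x (x (Fin.last (M + 1)) + p₁ / ω.f (Fin.last (M + 2))) : Fin (M + 3) → ℂ)
    have hyi : ∀ i : Fin (M + 2), y i.succ.castSucc = x i := by
      intro i
      simp only [y, ← Fin.succ_castSucc, Fin.cons_succ, Fin.snoc_castSucc]
    have hyx : interior M y = x := funext hyi
    have hy₀ : ω.quasiDiff y 0 = p₀ := by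
      have h0 : y (0 : Fin (M + 3)).succ = x 0 := hyi 0
      have h1 : y (0 : Fin (M + 3)).castSucc = x 0 - p₀ / ω.f 0 := rfl
      rw [SLE.quasiDiff, diff, h0, h1]
      field_simp
      ring
    have hy₁ : ω.quasiDiff y (Fin.last (M + 2)) = p₁ := by
      have h0 : y (Fin.last (M + 2)).castSucc = x (Fin.last (M + 1)) := by
        rw [← hyi, Fin.succ_last]
      have h1 : y (Fin.last (M + 2)).succ
          = x (Fin.last (M + 1)) + p₁ / ω.f (Fin.last (M + 2)) := by
        simp only [y, Fin.cons_succ, Fin.snoc_last]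
      rw [SLE.quasiDiff, diff, h0, h1]
      field_simp
      ring
    have hsol : ω.IsSolution μ y := by
      rw [isSolution_iff]
      intro v
      rw [hyx, hy₀, hy₁]
      have h1 := hg v
      rw [hgv] at h1
      linear_combination h1
    have hbc : bc.Holds ω y := by
      rw [h.holds_iff, hyx, hy₀, hy₁]
      refine ⟨hxK, fun η hη => ?_⟩
      rw [← hlift, hxw, boundaryValues_boundaryLift]
      rw [Submodule.mem_comap, boundaryValues_boundaryLift]
      exact hη
    exact ⟨⟨y, hsol, hbc⟩, Subtype.ext (Subtype.ext hyx)⟩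

theorem Reduces.exists_diagonalizes (h : Reduces ω bc z r b K) :
    ∃ (e : K.comap (boundaryValues M) ≃ₗ[ℂ] (Fin (finrank ℂ K + M) → ℂ)) (lam : ℕ → ℝ),
      IsEigenvalueSeq ω bc (finrank ℂ K + M) lam ∧
      Diagonalizes (restrictForm (K.comap (boundaryValues M)) (energyForm ω z r b))
        (restrictForm (K.comap (boundaryValues M)) (weightForm ω)) e lam := by
  obtain ⟨e, lam, hm, hd⟩ := DiscreteSL.exists_diagonalizes
    (B := restrictForm (K.comap (boundaryValues M)) (energyForm ω z r b))
    (W := restrictForm (K.comap (boundaryValues M)) (weightForm ω))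
    (fun _ _ => conj_energyForm ω z r b _ _) (fun _ _ => conj_weightForm ω _ _)
    (fun _ => weightForm_nonneg ω _)
    (fun u hu => Subtype.ext (weightForm_definite ω u (by
      rw [restrictForm_apply] at hu
      rw [hu, Complex.zero_re])))
    (finrank_comap_boundaryValues K)
  refine ⟨e, lam, ⟨hm, fun μ => ?_⟩, hd⟩
  rw [h.finrank_eigenspace, hd.finrank_weakEigenspace]

theorem Reduces.hasExactlyEigenvalues (h : Reduces ω bc z r b K) {k : ℕ}
    (hk : finrank ℂ K + M = k) : HasExactlyEigenvalues ω bc k := by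
  subst hk
  obtain ⟨_, lam, hl, _⟩ := h.exists_diagonalizes
  exact ⟨lam, hl⟩

/-- Transfers the diagonalization from the constructed eigenvalue list to an arbitrary one, by
uniqueness of sorted lists. -/
theorem Reduces.diagonalizes_of_isEigenvalueSeq (h : Reduces ω bc z r b K) {k : ℕ} {lam : ℕ → ℝ}
    (hl : IsEigenvalueSeq ω bc k lam) :
    k = finrank ℂ K + M ∧
    ∃ e : K.comap (boundaryValues M) ≃ₗ[ℂ] (Fin (finrank ℂ K + M) → ℂ),
      Diagonalizes (restrictForm (K.comap (boundaryValues M)) (energyForm ω z r b))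
        (restrictForm (K.comap (boundaryValues M)) (weightForm ω)) e lam := by
  obtain ⟨e, lam', hl', hd⟩ := h.exists_diagonalizes
  obtain ⟨hk, heq⟩ := sorted_seq_unique hl'.1 hl.1 fun μ => (hl'.2 μ).symm.trans (hl.2 μ)
  exact ⟨hk.symm, e, hd.congr heq⟩

/-- Comparison of the eigenvalues of two boundary value problems whose boundary forms are
comparable on a common subspace `K`. -/
theorem Reduces.eigenvalue_le {bc₁ bc₂ : SelfAdjointBC} {z₁ z₂ : ℂ} {r₁ b₁ r₂ b₂ : ℝ}
    {K₁ K₂ : Submodule ℂ (ℂ × ℂ)} (h₁ : Reduces ω bc₁ z₁ r₁ b₁ K₁) (h₂ : Reduces ω bc₂ z₂ r₂ b₂ K₂)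
    {k₁ k₂ : ℕ} {lam₁ lam₂ : ℕ → ℝ} (hl₁ : IsEigenvalueSeq ω bc₁ k₁ lam₁)
    (hl₂ : IsEigenvalueSeq ω bc₂ k₂ lam₂) (hK₁ : K ≤ K₁) (hK₂ : K ≤ K₂) {d : ℕ}
    (hd : finrank ℂ K₁ ≤ finrank ℂ K + d)
    (hle : ∀ ξ ∈ K, (boundaryForm z₂ r₂ b₂ ξ ξ).re ≤ (boundaryForm z₁ r₁ b₁ ξ ξ).re) {n : ℕ}
    (hn₁ : n + d < finrank ℂ K₁ + M) (hn₂ : n < finrank ℂ K₂ + M) : lam₂ n ≤ lam₁ (n + d) := by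
  obtain ⟨rfl, e₁, hd₁⟩ := h₁.diagonalizes_of_isEigenvalueSeq hl₁
  obtain ⟨rfl, e₂, hd₂⟩ := h₂.diagonalizes_of_isEigenvalueSeq hl₂
  refine DiscreteSL.eigenvalue_le (Z := K.comap (boundaryValues M)) (weightForm_nonneg ω)
    (weightForm_definite ω) hd₁ hd₂ hl₁.1 hl₂.1 (Submodule.comap_mono hK₁)
    (Submodule.comap_mono hK₂) ?_ ?_ hn₁ hn₂
  · rw [finrank_comap_boundaryValues, finrank_comap_boundaryValues]
    omega
  · intro x hx
    rw [energyForm_apply, energyForm_apply, Complex.add_re, Complex.add_re]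
    exact add_le_add le_rfl (hle _ hx)

end WeakFormulation

/-! ### The forms and domains of the three families of boundary conditions. -/

section BoundaryConditions

variable {M : ℕ}

/-- The boundary values that `A(a₁₂, b₂₁)` admits, where `c = a₁₂ - 1 / f₀`. -/
def chartDomain (z : ℂ) (c : ℝ) : Submodule ℂ (ℂ × ℂ) where
  carrier := {ξ | c = 0 → ξ.1 + conj z * ξ.2 = 0}
  zero_mem' := by simp
  add_mem' := by
    intro ξ η hξ hη hc
    have h1 := hξ hc
    have h2 := hη hc
    rw [Prod.fst_add, Prod.snd_add]
    linear_combination h1 + h2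
  smul_mem' := by
    intro s ξ hξ hc
    have h1 := hξ hc
    rw [Prod.smul_fst, Prod.smul_snd, smul_eq_mul, smul_eq_mul]
    linear_combination s * h1

theorem mem_chartDomain {z : ℂ} {c : ℝ} {ξ : ℂ × ℂ} :
    ξ ∈ chartDomain z c ↔ (c = 0 → ξ.1 + conj z * ξ.2 = 0) := Iff.rfl

/-- The boundary values that `S₂(a₁₂)` admits, where `c = a₁₂ - 1 / f₀`. -/
def limitDomain (c : ℝ) : Submodule ℂ (ℂ × ℂ) where
  carrier := {ξ | ξ.2 = 0 ∧ (c = 0 → ξ.1 = 0)}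
  zero_mem' := by simp
  add_mem' := by
    rintro ξ η ⟨hξ, hξ'⟩ ⟨hη, hη'⟩
    refine ⟨by rw [Prod.snd_add, hξ, hη, add_zero], fun hc => ?_⟩
    rw [Prod.fst_add, hξ' hc, hη' hc, add_zero]
  smul_mem' := by
    rintro s ξ ⟨hξ, hξ'⟩
    refine ⟨by rw [Prod.smul_snd, hξ, smul_zero], fun hc => ?_⟩
    rw [Prod.smul_fst, hξ' hc, smul_zero]

theorem mem_limitDomain {c : ℝ} {ξ : ℂ × ℂ} :
    ξ ∈ limitDomain c ↔ ξ.2 = 0 ∧ (c = 0 → ξ.1 = 0) := Iff.rfl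

theorem limitDomain_le_chartDomain (z : ℂ) (c : ℝ) : limitDomain c ≤ chartDomain z c := by
  rintro ξ ⟨h1, h2⟩ hc
  rw [h1, h2 hc, mul_zero, add_zero]

theorem chartDomain_of_ne (z : ℂ) {c : ℝ} (hc : c ≠ 0) : chartDomain z c = ⊤ :=
  eq_top_iff.2 fun _ _ h => absurd h hc

theorem finrank_top_boundary : finrank ℂ (⊤ : Submodule ℂ (ℂ × ℂ)) = 2 := by
  rw [finrank_top, finrank_prod, finrank_self]

theorem finrank_chartDomain_of_ne (z : ℂ) {c : ℝ} (hc : c ≠ 0) :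
    finrank ℂ (chartDomain z c) = 2 := by
  rw [chartDomain_of_ne z hc, finrank_top_boundary]

theorem finrank_chartDomain_zero (z : ℂ) : finrank ℂ (chartDomain z 0) = 1 := by
  have : chartDomain z 0 = Submodule.span ℂ {((-conj z, 1) : ℂ × ℂ)} := by
    ext ξ
    rw [mem_chartDomain, Submodule.mem_span_singleton]
    constructor
    · intro h
      refine ⟨ξ.2, ?_⟩
      ext
      · simp only [Prod.smul_mk, smul_eq_mul]
        linear_combination -(h rfl)
      · simp
    · rintro ⟨s, rfl⟩ _
      simp only [Prod.smul_mk, smul_eq_mul]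
      ring
  rw [this, finrank_span_singleton]
  simp

theorem finrank_limitDomain_of_ne {c : ℝ} (hc : c ≠ 0) : finrank ℂ (limitDomain c) = 1 := by
  have : limitDomain c = Submodule.span ℂ {((1, 0) : ℂ × ℂ)} := by
    ext ξ
    rw [mem_limitDomain, Submodule.mem_span_singleton]
    constructor
    · rintro ⟨h, _⟩
      refine ⟨ξ.1, ?_⟩
      ext
      · simp
      · simp [h]
    · rintro ⟨s, rfl⟩
      simp [hc]
  rw [this, finrank_span_singleton]
  simp

theorem finrank_limitDomain_zero : finrank ℂ (limitDomain 0) = 0 := by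
  have : limitDomain 0 = ⊥ := by
    rw [Submodule.eq_bot_iff]
    rintro ξ ⟨h1, h2⟩
    exact Prod.ext (h2 rfl) h1
  rw [this, finrank_bot]

variable (ω : SLE (M + 2))

/-- The rows become `x₀ + c p₀ + z̄ x₁ = 0` and `p₁ = -z p₀ - b x₁`. The second turns the boundary
term into `conj (η.1 + z̄ η.2) * p₀ + b * conj η.2 * x₁`. If `c ≠ 0`, the first row determines `p₀`;
if `c = 0`, the factor of `p₀` vanishes on the domain, consistently with `1 / 0 = 0`. -/
theorem chart14_reduces (z : ℂ) (a b : ℝ) :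
    Reduces ω (chart14 z a b) z (1 / (a - 1 / ω.f 0)) b (chartDomain z (a - 1 / ω.f 0)) := by
  intro x₀ x₁ p₀ p₁
  set c : ℝ := a - 1 / ω.f 0 with hc
  have hac : (a : ℂ) = c + 1 / ω.f 0 := by rw [hc]; push_cast; ring
  have hmat : (chart14 z a b).A *ᵥ ![x₀ - p₀ / ω.f 0, p₀] + (chart14 z a b).B *ᵥ ![x₁, p₁] = 0 ↔
      (x₀ + c * p₀ + conj z * x₁ = 0 ∧ z * p₀ + b * x₁ + p₁ = 0) := by
    rw [funext_iff, Fin.forall_fin_two]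
    refine and_congr ?_ ?_
    · simp only [chart14, Matrix.mulVec, dotProduct, Fin.sum_univ_two, Pi.add_apply, Pi.zero_apply,
        Matrix.of_apply, Matrix.cons_val_zero, Matrix.cons_val_one]
      rw [hac]
      refine Eq.congr ?_ rfl
      ring
    · simp only [chart14, Matrix.mulVec, dotProduct, Fin.sum_univ_two, Pi.add_apply, Pi.zero_apply,
        Matrix.of_apply, Matrix.cons_val_zero, Matrix.cons_val_one]
      refine Eq.congr ?_ rfl
      ring
  rw [hmat, mem_chartDomain]
  by_cases h0 : c = 0
  · simp only [h0, boundaryForm, mem_chartDomain]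
    constructor
    · rintro ⟨h1, h2⟩
      refine ⟨fun _ => by simpa using h1, fun η hη => ?_⟩
      have h3 := congrArg conj (hη trivial)
      simp only [map_add, map_mul, Complex.conj_conj, map_zero] at h3
      push_cast
      linear_combination p₀ * h3 - conj η.2 * h2
    · rintro ⟨h1, h2⟩
      -- This vector spans the constrained domain, so testing with it recovers the whole second row.
      have h3 := h2 (-conj z, 1) (by simp)
      have h4 := h1 trivial
      simp only [map_neg, Complex.conj_conj, map_one] at h3
      push_cast at h3 ⊢
      exact ⟨by linear_combination h4, by linear_combination -h3⟩
  · have hc0 : (c : ℂ) ≠ 0 := Complex.ofReal_ne_zero.2 h0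
    simp only [h0, boundaryForm, mem_chartDomain, false_imp_iff, forall_const, true_and, map_add,
      map_mul, Complex.conj_conj]
    push_cast
    constructor
    · rintro ⟨h1, h2⟩ η
      field_simp
      linear_combination (conj η.1 + z * conj η.2) * h1 - c * conj η.2 * h2
    · intro h
      have h1 := h (1, 0)
      have h2 := h (0, 1)
      simp only [map_one, map_zero, one_mul, mul_zero, zero_mul, mul_one, sub_zero, zero_sub,
        add_zero, zero_add] at h1 h2
      field_simp at h1 h2
      have h3 : x₀ + c * p₀ + conj z * x₁ = 0 := by linear_combination h1
      refine ⟨h3, mul_left_cancel₀ hc0 ?_⟩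
      linear_combination z * h3 - h2

/-- The condition is `p₀ = 0`, `p₁ = -b x₁`, with no constraint on the domain. As `r = 0`, any `z`
is allowed, in particular that of the chart it is compared with. -/
theorem limitS₁_reduces (z : ℂ) (b : ℝ) : Reduces ω (limitS₁ b) z 0 b ⊤ := by
  intro x₀ x₁ p₀ p₁
  rw [funext_iff, Fin.forall_fin_two]
  simp only [limitS₁, Matrix.mulVec, dotProduct, Fin.sum_univ_two, Pi.add_apply, Pi.zero_apply,
    Matrix.of_apply, Matrix.cons_val_zero, Matrix.cons_val_one, boundaryForm, Submodule.mem_top,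
    true_and, forall_const]
  push_cast
  constructor
  · rintro ⟨h1, h2⟩ η
    linear_combination conj η.1 * h1 - conj η.2 * h2
  · intro h
    have h1 := h (1, 0)
    have h2 := h (0, 1)
    simp only [map_one, map_zero] at h1 h2
    exact ⟨by linear_combination h1, by linear_combination -h2⟩

/-- The domain forces the second boundary value to vanish, so `b` is arbitrary. This freedom lets
`S₂` be compared, with the same form, to the chart problem for any `b₂₁`. -/
theorem limitS₂_reduces (z : ℂ) (a b : ℝ) :
    Reduces ω (limitS₂ a) z (1 / (a - 1 / ω.f 0)) b (limitDomain (a - 1 / ω.f 0)) := by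
  intro x₀ x₁ p₀ p₁
  set c : ℝ := a - 1 / ω.f 0 with hc
  have hac : (a : ℂ) = c + 1 / ω.f 0 := by rw [hc]; push_cast; ring
  have hmat : (limitS₂ a).A *ᵥ ![x₀ - p₀ / ω.f 0, p₀] + (limitS₂ a).B *ᵥ ![x₁, p₁] = 0 ↔
      (x₀ + c * p₀ = 0 ∧ x₁ = 0) := by
    rw [funext_iff, Fin.forall_fin_two]
    simp only [limitS₂, Matrix.mulVec, dotProduct, Fin.sum_univ_two, Pi.add_apply, Pi.zero_apply,
      Matrix.of_apply, Matrix.cons_val_zero, Matrix.cons_val_one]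
    rw [hac]
    refine and_congr (Eq.congr ?_ rfl) (Eq.congr ?_ rfl) <;> ring
  rw [hmat, mem_limitDomain]
  simp only [boundaryForm]
  constructor
  · rintro ⟨h1, h2⟩
    refine ⟨⟨h2, fun h0 => ?_⟩, ?_⟩
    · simpa [h0] using h1
    · rintro η ⟨hη, hη'⟩
      by_cases h0 : c = 0
      · simp [hη, hη' h0]
      · have hc0 : (c : ℂ) ≠ 0 := Complex.ofReal_ne_zero.2 h0
        rw [hη, h2]
        push_cast
        simp only [map_zero, mul_zero, add_zero, zero_mul, sub_zero]
        field_simp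
        linear_combination conj η.1 * h1
  · rintro ⟨⟨h1, h2⟩, h3⟩
    refine ⟨?_, h1⟩
    by_cases h0 : c = 0
    · rw [h0, show x₀ = 0 from h2 h0]
      simp
    · have hc0 : (c : ℂ) ≠ 0 := Complex.ofReal_ne_zero.2 h0
      have h4 := h3 (1, 0) ⟨rfl, fun h => absurd h h0⟩
      rw [show x₁ = 0 from h1] at h4
      push_cast at h4
      simp only [map_one, map_zero, mul_zero, add_zero, zero_mul, sub_zero, one_mul] at h4
      field_simp at h4
      linear_combination h4

/-- The boundary form decreases in `r`. -/
theorem boundaryForm_anti_left (z : ℂ) {r₁ r₂ : ℝ} (b : ℝ) (h : r₂ ≤ r₁) (ξ : ℂ × ℂ) :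
    (boundaryForm z r₁ b ξ ξ).re ≤ (boundaryForm z r₂ b ξ ξ).re := by
  rw [boundaryForm_self_re, boundaryForm_self_re]
  exact add_le_add (neg_le_neg (mul_le_mul_of_nonneg_right h (Complex.normSq_nonneg _))) le_rfl

/-- The boundary form increases in `b`. -/
theorem boundaryForm_mono_right (z : ℂ) (r : ℝ) {b₁ b₂ : ℝ} (h : b₁ ≤ b₂) (ξ : ℂ × ℂ) :
    (boundaryForm z r b₁ ξ ξ).re ≤ (boundaryForm z r b₂ ξ ξ).re := by
  rw [boundaryForm_self_re, boundaryForm_self_re]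
  exact add_le_add le_rfl (mul_le_mul_of_nonneg_right h (Complex.normSq_nonneg _))

/-- On the boundary values annihilated by `ξ ↦ ξ₁ + z̄ ξ₂` the boundary form does not depend
on `r`. -/
theorem boundaryForm_eq_of_mem {z : ℂ} (r₁ r₂ b : ℝ) {ξ : ℂ × ℂ} (h : ξ ∈ chartDomain z 0) :
    (boundaryForm z r₁ b ξ ξ).re = (boundaryForm z r₂ b ξ ξ).re := by
  rw [boundaryForm_self_re, boundaryForm_self_re, h rfl]
  simp

end BoundaryConditions

end DiscreteSL

/-! ### Eigenvalue counts and the two chains of inequalities. -/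

theorem theorem3p2 {N : ℕ} (hN : 2 ≤ N) (ω : DiscreteSL.SLE N) (z : ℂ) :
    -- the numbers of eigenvalues
    (∀ a₁₂ b₂₁ : ℝ,
      (a₁₂ ≠ 1 / ω.f 0 →
        DiscreteSL.HasExactlyEigenvalues ω (DiscreteSL.chart14 z a₁₂ b₂₁) N) ∧
      (a₁₂ = 1 / ω.f 0 →
        DiscreteSL.HasExactlyEigenvalues ω (DiscreteSL.chart14 z a₁₂ b₂₁) (N - 1)) ∧
      DiscreteSL.HasExactlyEigenvalues ω (DiscreteSL.limitS₁ b₂₁) N ∧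
      (a₁₂ ≠ 1 / ω.f 0 →
        DiscreteSL.HasExactlyEigenvalues ω (DiscreteSL.limitS₂ a₁₂) (N - 1)) ∧
      (a₁₂ = 1 / ω.f 0 →
        DiscreteSL.HasExactlyEigenvalues ω (DiscreteSL.limitS₂ a₁₂) (N - 2))) ∧
    -- (i) the inequalities along the loop in `a₁₂`
    (∀ b₂₁ a₁ a₂ a₃ a₄ : ℝ, a₁ < a₂ → a₂ ≤ 1 / ω.f 0 → 1 / ω.f 0 < a₃ → a₃ < a₄ →
      ∀ (k₁ k₂ k₃ k₄ k : ℕ) (lam₁ lam₂ lam₃ lam₄ lamS : ℕ → ℝ),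
      DiscreteSL.IsEigenvalueSeq ω (DiscreteSL.chart14 z a₁ b₂₁) k₁ lam₁ →
      DiscreteSL.IsEigenvalueSeq ω (DiscreteSL.chart14 z a₂ b₂₁) k₂ lam₂ →
      DiscreteSL.IsEigenvalueSeq ω (DiscreteSL.chart14 z a₃ b₂₁) k₃ lam₃ →
      DiscreteSL.IsEigenvalueSeq ω (DiscreteSL.chart14 z a₄ b₂₁) k₄ lam₄ →
      DiscreteSL.IsEigenvalueSeq ω (DiscreteSL.limitS₁ b₂₁) k lamS →
      (∀ n, n < N → lam₃ n ≤ lam₄ n ∧ lam₄ n ≤ lamS n ∧ lamS n ≤ lam₁ n) ∧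
      (∀ n, n + 1 < N → lam₁ n ≤ lam₂ n ∧ lam₂ n ≤ lam₃ (n + 1)) ∧
      (a₂ < 1 / ω.f 0 → lam₁ (N - 1) ≤ lam₂ (N - 1))) ∧
    -- (ii) the inequalities along the loop in `b₂₁`
    (∀ a₁₂ b₁ b₂ : ℝ, b₁ < b₂ →
      ∀ (k₁ k₂ k : ℕ) (lam₁ lam₂ lamS : ℕ → ℝ),
      DiscreteSL.IsEigenvalueSeq ω (DiscreteSL.chart14 z a₁₂ b₁) k₁ lam₁ →
      DiscreteSL.IsEigenvalueSeq ω (DiscreteSL.chart14 z a₁₂ b₂) k₂ lam₂ →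
      DiscreteSL.IsEigenvalueSeq ω (DiscreteSL.limitS₂ a₁₂) k lamS →
      (∀ n, n + 1 < N → lam₁ n ≤ lam₂ n) ∧
      (∀ n, n + 2 < N → lam₂ n ≤ lamS n ∧ lamS n ≤ lam₁ (n + 1)) ∧
      (a₁₂ ≠ 1 / ω.f 0 →
        lam₂ (N - 2) ≤ lamS (N - 2) ∧ lamS (N - 2) ≤ lam₁ (N - 1) ∧
          lam₁ (N - 1) ≤ lam₂ (N - 1))) := by
  obtain ⟨M, rfl⟩ := Nat.exists_eq_add_of_le' hN
  refine ⟨fun a b => ⟨fun ha => ?_, fun ha => ?_, ?_, fun ha => ?_, fun ha => ?_⟩, ?_, ?_⟩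
  · refine (DiscreteSL.chart14_reduces ω z a b).hasExactlyEigenvalues ?_
    rw [DiscreteSL.finrank_chartDomain_of_ne z (sub_ne_zero.2 ha)]
    omega
  · refine (DiscreteSL.chart14_reduces ω z a b).hasExactlyEigenvalues ?_
    rw [sub_eq_zero.2 ha, DiscreteSL.finrank_chartDomain_zero]
    omega
  · refine (DiscreteSL.limitS₁_reduces ω z b).hasExactlyEigenvalues ?_
    rw [DiscreteSL.finrank_top_boundary]
    omega
  · refine (DiscreteSL.limitS₂_reduces ω z a b).hasExactlyEigenvalues ?_
    rw [DiscreteSL.finrank_limitDomain_of_ne (sub_ne_zero.2 ha)]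
    omega
  · refine (DiscreteSL.limitS₂_reduces ω z a b).hasExactlyEigenvalues ?_
    rw [sub_eq_zero.2 ha, DiscreteSL.finrank_limitDomain_zero]
    omega
  · intro b a₁ a₂ a₃ a₄ h12 h2 h3 h34 k₁ k₂ k₃ k₄ k lam₁ lam₂ lam₃ lam₄ lamS l1 l2 l3 l4 lS
    have R1 := DiscreteSL.chart14_reduces ω z a₁ b
    have R2 := DiscreteSL.chart14_reduces ω z a₂ b
    have R3 := DiscreteSL.chart14_reduces ω z a₃ b
    have R4 := DiscreteSL.chart14_reduces ω z a₄ b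
    have RS := DiscreteSL.limitS₁_reduces ω z b
    have c1 : a₁ - 1 / ω.f 0 < 0 := sub_neg.2 (h12.trans_le h2)
    have c3 : 0 < a₃ - 1 / ω.f 0 := sub_pos.2 h3
    have c34 : a₃ - 1 / ω.f 0 < a₄ - 1 / ω.f 0 := sub_lt_sub_right h34 _
    have c12 : a₁ - 1 / ω.f 0 < a₂ - 1 / ω.f 0 := sub_lt_sub_right h12 _
    have c2 : a₂ - 1 / ω.f 0 ≤ 0 := sub_nonpos.2 h2
    generalize a₁ - 1 / ω.f 0 = d₁ at *
    generalize hd₂ : a₂ - 1 / ω.f 0 = d₂ at *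
    generalize a₃ - 1 / ω.f 0 = d₃ at *
    generalize a₄ - 1 / ω.f 0 = d₄ at *
    rw [DiscreteSL.chartDomain_of_ne z c1.ne] at R1
    rw [DiscreteSL.chartDomain_of_ne z c3.ne'] at R3
    rw [DiscreteSL.chartDomain_of_ne z (c3.trans c34).ne'] at R4
    have ht := DiscreteSL.finrank_top_boundary
    have hlt : ∀ n, n < M + 2 → n + 0 < Module.finrank ℂ (⊤ : Submodule ℂ (ℂ × ℂ)) + M := by
      intro n hn
      omega
    have h12' : ∀ n, n < Module.finrank ℂ (DiscreteSL.chartDomain z d₂) + M →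
        lam₁ n ≤ lam₂ n := by
      intro n hn
      refine R2.eigenvalue_le R1 l2 l1 le_rfl le_top (d := 0) le_rfl (fun ξ hξ => ?_) hn ?_
      -- At the critical value the `a₂`-domain is the constrained line, where the forms agree for
      -- every `r`; below it, `1/c` is decreasing on the negative axis.
      · rcases c2.eq_or_lt with h0 | h0
        · rw [h0] at hξ
          exact (DiscreteSL.boundaryForm_eq_of_mem _ _ _ hξ).le
        · exact DiscreteSL.boundaryForm_anti_left _ _ (one_div_le_one_div_of_neg_of_le h0 c12.le) _
      · exact hn.trans_le (Nat.add_le_add_right (Submodule.finrank_mono le_top) M)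
    have hdim : 1 ≤ Module.finrank ℂ (DiscreteSL.chartDomain z d₂) := by
      rcases eq_or_ne d₂ 0 with h0 | h0
      · rw [h0, DiscreteSL.finrank_chartDomain_zero]
      · rw [DiscreteSL.finrank_chartDomain_of_ne z h0]
        omega
    refine ⟨fun n hn => ⟨?_, ?_, ?_⟩, fun n hn => ⟨?_, ?_⟩, fun ha => ?_⟩
    · exact R4.eigenvalue_le R3 l4 l3 le_rfl le_rfl (d := 0) le_rfl
        (fun ξ _ => DiscreteSL.boundaryForm_anti_left _ _ (one_div_le_one_div_of_le c3 c34.le) _)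
        (hlt n hn) (hlt n hn)
    · exact RS.eigenvalue_le R4 lS l4 le_rfl le_rfl (d := 0) le_rfl
        (fun ξ _ => DiscreteSL.boundaryForm_anti_left _ _ (one_div_pos.2 (c3.trans c34)).le _)
        (hlt n hn) (hlt n hn)
    · exact R1.eigenvalue_le RS l1 lS le_rfl le_rfl (d := 0) le_rfl
        (fun ξ _ => DiscreteSL.boundaryForm_anti_left _ _ (one_div_neg.2 c1).le _)
        (hlt n hn) (hlt n hn)
    · exact h12' n (by omega)
    -- `1/c` is positive for `a₃`, and nonpositive for `a₂`, so the forms are not ordered the right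
    -- way on the full space. On the line `y_1 + z̄ y_N = 0` they agree, and its codimension one
    -- costs one index.
    · refine R3.eigenvalue_le R2 l3 l2 (K := DiscreteSL.chartDomain z 0) le_top
        (fun ξ hξ _ => hξ rfl) (d := 1) ?_
        (fun ξ hξ => (DiscreteSL.boundaryForm_eq_of_mem _ _ _ hξ).le) (hlt _ hn) (by omega)
      rw [ht, DiscreteSL.finrank_chartDomain_zero]
    · refine h12' _ ?_
      rw [DiscreteSL.finrank_chartDomain_of_ne z (hd₂ ▸ (sub_neg.2 ha).ne)]
      omega
  · intro a b₁ b₂ hb k₁ k₂ k lam₁ lam₂ lamS l1 l2 lS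
    have R1 := DiscreteSL.chart14_reduces ω z a b₁
    have R2 := DiscreteSL.chart14_reduces ω z a b₂
    -- The same `S₂` problem is represented once with each `b`, so that each comparison below is
    -- between identical forms.
    have RS1 := DiscreteSL.limitS₂_reduces ω z a b₁
    have RS2 := DiscreteSL.limitS₂_reduces ω z a b₂
    have hdim : Module.finrank ℂ (DiscreteSL.chartDomain z (a - 1 / ω.f 0))
        = Module.finrank ℂ (DiscreteSL.limitDomain (a - 1 / ω.f 0)) + 1 := by
      rcases eq_or_ne (a - 1 / ω.f 0) 0 with h0 | h0
      · rw [h0, DiscreteSL.finrank_chartDomain_zero, DiscreteSL.finrank_limitDomain_zero]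
      · rw [DiscreteSL.finrank_chartDomain_of_ne z h0, DiscreteSL.finrank_limitDomain_of_ne h0]
    have hle := DiscreteSL.limitDomain_le_chartDomain z (a - 1 / ω.f 0)
    have h12 : ∀ n, n < Module.finrank ℂ (DiscreteSL.limitDomain (a - 1 / ω.f 0)) + 1 + M →
        lam₁ n ≤ lam₂ n := fun n hn =>
      R2.eigenvalue_le R1 l2 l1 le_rfl le_rfl (d := 0) le_rfl
        (fun ξ _ => DiscreteSL.boundaryForm_mono_right _ _ hb.le _) (by omega) (by omega)
    have h2S : ∀ n, n < Module.finrank ℂ (DiscreteSL.limitDomain (a - 1 / ω.f 0)) + M →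
        lam₂ n ≤ lamS n := fun n hn =>
      RS2.eigenvalue_le R2 lS l2 le_rfl hle (d := 0) le_rfl (fun ξ _ => le_rfl)
        (by omega) (by omega)
    -- The limit domain has codimension one in the chart domain, hence the shift by one.
    have hS1 : ∀ n, n < Module.finrank ℂ (DiscreteSL.limitDomain (a - 1 / ω.f 0)) + M →
        lamS n ≤ lam₁ (n + 1) := fun n hn =>
      R1.eigenvalue_le RS1 l1 lS hle le_rfl (d := 1) hdim.le (fun ξ _ => le_rfl)
        (by omega) (by omega)
    refine ⟨fun n hn => h12 n (by omega), fun n hn => ⟨h2S n (by omega), hS1 n (by omega)⟩,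
      fun ha => ?_⟩
    have h1 := DiscreteSL.finrank_limitDomain_of_ne (sub_ne_zero.2 ha)
    exact ⟨h2S _ (by omega), hS1 _ (by omega), h12 _ (by omega)⟩
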